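/- A HyperCTL$^*$ formula is given by the grammar $\varphi ::= a_\pi \mid \neg\varphi \mid \varphi\vee\varphi \mid \mathbf{X}\varphi \mid \varphi\,\mathbf{U}\,\varphi \mid \exists\pi.\,\varphi \mid \forall\pi.\,\varphi$, where $a$ ranges over a countable set of atomic propositions and $\pi$ over a countable set of path variables (both identified with $\mathbb{N}$). A sentence is a formula without free path variables in which every temporal operator is in the scope of a path quantifier. A transition system $\mathcal{T}=(V,E,v_I,\lambda)$ consists of a set $V$ of vertices of arbitrary cardinality, edges $E\subseteq V\times V$, an initial vertex $v_I\in V$ and a labelling $\lambda$ of the vertices by sets of atomic propositions; it is total if every vertex has an outgoing edge. A path is an infinite sequence of vertices $\rho(0)\rho(1)\cdots$ with $(\rho(n),\rho(n+1))\in E$ for all $n$. For a partial assignment $\Pi$ of paths to path variables let $\mathrm{rcnt}(\Pi)$ be the first vertex of the path of the most recently assigned variable, and $v_I$ if $\Pi$ is empty; let $\Pi[j,\infty)$ be obtained by replacing each path by its suffix from position $j$. Then $\Pi\models a_\pi$ iff $a\in\lambda(\Pi(\pi)(0))$; Boolean connectives are as usual; $\Pi\models\mathbf{X}\varphi$ iff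 $\Pi[1,\infty)\models\varphi$; $\Pi\models\varphi\,\mathbf{U}\,\psi$ iff there is $j\ge 0$ with $\Pi[j,\infty)\models\psi$ and $\Pi[i,\infty)\models\varphi$ for all $0\le i<j$; and $\Pi\models\exists\pi.\,\varphi$ (resp. $\forall\pi.\,\varphi$) iff $\Pi[\pi\mapsto\rho]\models\varphi$ for some (resp. every) path $\rho$ starting in $\mathrm{rcnt}(\Pi)$. $\mathcal{T}$ is a model of a sentence $\varphi$ if the empty assignment satisfies $\varphi$ in $\mathcal{T}$. A set $S\subseteq\mathbb{N}$ is in $\Sigma^2_1$ if $S=\{x\in\mathbb{N}\mid \exists \mathcal{X}_1\cdots\exists\mathcal{X}_k.\ \psi(x,\mathcal{X}_1,\ldots,\mathcal{X}_k)\}$, where the $\mathcal{X}_i$ range over type 2 objects (functions from $\mathbb{N}^{\mathbb{N}}$ to $\mathbb{N}$) and $\psi$ is a formula of arithmetic over $(\mathbb{N},0,1,+,\cdot,<)$ and function application, which quantifies only over type 0 objects (natural numbers) and type 1 objects (functions from $\mathbb{N}$ to $\mathbb{N}$). Proposition. HyperCTL$^*$ satisfiability is in $\Sigma^2_1$: under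 a standard (explicitly given, computable and injective) encoding of formulas by natural numbers, the set of codes of HyperCTL$^*$ sentences that have a total transition system as a model is in $\Sigma^2_1$. The same holds for the set of codes of sentences that have a model among all (not necessarily total) transition systems. -/

import Mathlib

/-! ## HyperCTL* -/

/-- HyperCTL* formulas
`φ ::= a_π | ¬φ | φ ∨ φ | X φ | φ U φ | ∃π. φ | ∀π. φ`,
with atomic propositions `a : ℕ` and path variables `π : ℕ`. -/
inductive HyperCTL : Type
  | atom (a π : ℕ) : HyperCTL
  | neg (φ : HyperCTL) : HyperCTL
  | or (φ ψ : HyperCTL) : HyperCTL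
  | next (φ : HyperCTL) : HyperCTL
  | untl (φ ψ : HyperCTL) : HyperCTL
  | ex (π : ℕ) (φ : HyperCTL) : HyperCTL
  | all (π : ℕ) (φ : HyperCTL) : HyperCTL

namespace HyperCTL

/-- The free path variables of a formula. -/
def freeVars : HyperCTL → Set ℕ
  | atom _ π => {π}
  | neg φ => φ.freeVars
  | or φ ψ => φ.freeVars ∪ ψ.freeVars
  | next φ => φ.freeVars
  | untl φ ψ => φ.freeVars ∪ ψ.freeVars
  | ex π φ => φ.freeVars \ {π}
  | all π φ => φ.freeVars \ {π}

/-- Every temporal operator occurs in the scope of a path quantifier. -/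
def Guarded : HyperCTL → Prop
  | atom _ _ => True
  | neg φ => φ.Guarded
  | or φ ψ => φ.Guarded ∧ ψ.Guarded
  | next _ => False
  | untl _ _ => False
  | ex _ _ => True
  | all _ _ => True

/-- Sentences: no free path variables, and temporal operators only below path quantifiers. -/
def IsSentence (φ : HyperCTL) : Prop :=
  φ.freeVars = ∅ ∧ φ.Guarded

/-- The encoding of formulas by natural numbers, based on the pairing bijection `Nat.pair`. -/
def code : HyperCTL → ℕ
  | atom a π => 7 * Nat.pair a π
  | neg φ => 7 * φ.code + 1
  | or φ ψ => 7 * Nat.pair φ.code ψ.code + 2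
  | next φ => 7 * φ.code + 3
  | untl φ ψ => 7 * Nat.pair φ.code ψ.code + 4
  | ex π φ => 7 * Nat.pair π φ.code + 5
  | all π φ => 7 * Nat.pair π φ.code + 6

/-- Distinct formulas have distinct codes. -/
theorem code_injective : Function.Injective code := by
  have key : ∀ a b r : ℕ, 7 * a + r = 7 * b + r → a = b := by omega
  intro φ
  induction φ with
  | atom a π =>
    intro ψ h
    cases ψ <;> simp only [code] at h <;> first
      | omega
      | (obtain ⟨h1, h2⟩ := Nat.pair_eq_pair.1 (key _ _ 0 h); rw [h1, h2])
  | neg φ ih =>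
    intro ψ h
    cases ψ <;> simp only [code] at h <;> first
      | omega
      | rw [ih (key _ _ _ h)]
  | next φ ih =>
    intro ψ h
    cases ψ <;> simp only [code] at h <;> first
      | omega
      | rw [ih (key _ _ _ h)]
  | or φ φ' ih ih' =>
    intro ψ h
    cases ψ <;> simp only [code] at h <;> first
      | omega
      | (obtain ⟨h1, h2⟩ := Nat.pair_eq_pair.1 (key _ _ _ h); rw [ih h1, ih' h2])
  | untl φ φ' ih ih' =>
    intro ψ h
    cases ψ <;> simp only [code] at h <;> first
      | omega
      | (obtain ⟨h1, h2⟩ := Nat.pair_eq_pair.1 (key _ _ _ h); rw [ih h1, ih' h2])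
  | ex π φ ih =>
    intro ψ h
    cases ψ <;> simp only [code] at h <;> first
      | omega
      | (obtain ⟨h1, h2⟩ := Nat.pair_eq_pair.1 (key _ _ _ h); rw [h1, ih h2])
  | all π φ ih =>
    intro ψ h
    cases ψ <;> simp only [code] at h <;> first
      | omega
      | (obtain ⟨h1, h2⟩ := Nat.pair_eq_pair.1 (key _ _ _ h); rw [h1, ih h2])

end HyperCTL

/-- A (possibly infinite) transition system: vertices, edges, an initial vertex, and a labelling
of the vertices by sets of atomic propositions. -/
structure TransitionSystem where
  Vertex : Type*
  Edge : Vertex → Vertex → Prop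
  init : Vertex
  label : Vertex → Set ℕ

namespace TransitionSystem

/-- Every vertex has an outgoing edge. -/
def Total (T : TransitionSystem) : Prop :=
  ∀ v, ∃ w, T.Edge v w

/-- `ρ` is an infinite path through `T` (starting at an arbitrary vertex). -/
def IsPath (T : TransitionSystem) (ρ : ℕ → T.Vertex) : Prop :=
  ∀ n, T.Edge (ρ n) (ρ (n + 1))

/-- Path assignments: a partial map from path variables to paths, which also remembers the path
assigned most recently (`none` if nothing has been assigned yet). -/
structure Assignment (T : TransitionSystem) where
  path : ℕ → Option (ℕ → T.Vertex)
  recent : Option (ℕ → T.Vertex)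

namespace Assignment

variable {T : TransitionSystem}

/-- The assignment `Π_∅` with empty domain. -/
def empty (T : TransitionSystem) : T.Assignment :=
  ⟨fun _ => none, none⟩

/-- `Π[π ↦ ρ]`. -/
def update (A : T.Assignment) (π : ℕ) (ρ : ℕ → T.Vertex) : T.Assignment :=
  ⟨Function.update A.path π (some ρ), some ρ⟩

/-- `Π[j, ∞)`: all assigned paths are replaced by their suffixes from position `j` onwards. -/
def suffix (A : T.Assignment) (j : ℕ) : T.Assignment :=
  ⟨fun π => (A.path π).map fun ρ n => ρ (n + j), A.recent.map fun ρ n => ρ (n + j)⟩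

/-- `rcnt(Π)`: the first vertex of the path of the most recently assigned variable; the initial
vertex of `T` if the assignment is empty. -/
def rcnt (A : T.Assignment) : T.Vertex :=
  match A.recent with
  | none => T.init
  | some ρ => ρ 0

end Assignment

/-- The satisfaction relation `T, Π ⊨ φ`. -/
def Sat (T : TransitionSystem) : HyperCTL → T.Assignment → Prop
  | .atom a π, A => ∃ ρ, A.path π = some ρ ∧ a ∈ T.label (ρ 0)
  | .neg φ, A => ¬ T.Sat φ A
  | .or φ ψ, A => T.Sat φ A ∨ T.Sat ψ A
  | .next φ, A => T.Sat φ (A.suffix 1)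
  | .untl φ ψ, A => ∃ j, T.Sat ψ (A.suffix j) ∧ ∀ i < j, T.Sat φ (A.suffix i)
  | .ex π φ, A => ∃ ρ, T.IsPath ρ ∧ ρ 0 = A.rcnt ∧ T.Sat φ (A.update π ρ)
  | .all π φ, A => ∀ ρ, T.IsPath ρ → ρ 0 = A.rcnt → T.Sat φ (A.update π ρ)

/-- `T` is a model of `φ`. -/
def Models (T : TransitionSystem) (φ : HyperCTL) : Prop :=
  T.Sat φ (Assignment.empty T)

end TransitionSystem

/-! ## Third-order arithmetic and the class `Σ²₁` -/

/-- Type 1 objects: functions from natural numbers to natural numbers. -/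
abbrev Type1 : Type := ℕ → ℕ

/-- Type 2 objects: functions from type 1 objects to natural numbers. -/
abbrev Type2 : Type := Type1 → ℕ

namespace Arith

/-- Terms (denoting natural numbers) with `m` type 0 variables, `n` type 1 variables and
`k` type 2 variables. -/
inductive Term (k m n : ℕ) : Type
  | var (i : Fin m) : Term k m n
  | zero : Term k m n
  | one : Term k m n
  | add (s t : Term k m n) : Term k m n
  | mul (s t : Term k m n) : Term k m n
  | app1 (Y : Fin n) (t : Term k m n) : Term k m n
  | app2 (X : Fin k) (Y : Fin n) : Term k m n

/-- The value of a term in the standard model. -/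
def Term.eval {k m n : ℕ} (X : Fin k → Type2) (x : Fin m → ℕ) (Y : Fin n → Type1) :
    Term k m n → ℕ
  | .var i => x i
  | .zero => 0
  | .one => 1
  | .add s t => s.eval X x Y + t.eval X x Y
  | .mul s t => s.eval X x Y * t.eval X x Y
  | .app1 j t => Y j (t.eval X x Y)
  | .app2 i j => X i (Y j)

/-- Formulas of arithmetic with quantification over type 0 and type 1 objects only, whose free
variables are among `m` type 0, `n` type 1 and `k` type 2 variables. A quantifier binds the
variable with index `0` of its body and shifts the other indices of that type by one. -/
inductive Formula (k : ℕ) : ℕ → ℕ → Type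
  | eq {m n : ℕ} (s t : Term k m n) : Formula k m n
  | lt {m n : ℕ} (s t : Term k m n) : Formula k m n
  | not {m n : ℕ} (φ : Formula k m n) : Formula k m n
  | and {m n : ℕ} (φ ψ : Formula k m n) : Formula k m n
  | or {m n : ℕ} (φ ψ : Formula k m n) : Formula k m n
  | ex0 {m n : ℕ} (φ : Formula k (m + 1) n) : Formula k m n
  | all0 {m n : ℕ} (φ : Formula k (m + 1) n) : Formula k m n
  | ex1 {m n : ℕ} (φ : Formula k m (n + 1)) : Formula k m n
  | all1 {m n : ℕ} (φ : Formula k m (n + 1)) : Formula k m n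

/-- Truth of a formula in the standard model. -/
def Formula.Holds {k : ℕ} (X : Fin k → Type2) :
    {m n : ℕ} → Formula k m n → (Fin m → ℕ) → (Fin n → Type1) → Prop
  | _, _, .eq s t, x, Y => s.eval X x Y = t.eval X x Y
  | _, _, .lt s t, x, Y => s.eval X x Y < t.eval X x Y
  | _, _, .not φ, x, Y => ¬ φ.Holds X x Y
  | _, _, .and φ ψ, x, Y => φ.Holds X x Y ∧ ψ.Holds X x Y
  | _, _, .or φ ψ, x, Y => φ.Holds X x Y ∨ ψ.Holds X x Y
  | _, _, .ex0 φ, x, Y => ∃ a : ℕ, φ.Holds X (Fin.cons a x) Y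
  | _, _, .all0 φ, x, Y => ∀ a : ℕ, φ.Holds X (Fin.cons a x) Y
  | _, _, .ex1 φ, x, Y => ∃ B : Type1, φ.Holds X x (Fin.cons B Y)
  | _, _, .all1 φ, x, Y => ∀ B : Type1, φ.Holds X x (Fin.cons B Y)

end Arith

/-- `S` is in `Σ²₁`: it has the form `{x ∈ ℕ | ∃ X₁ ⋯ ∃ X_k. ψ(x, X₁, …, X_k)}`, where the `Xᵢ`
range over type 2 objects and `ψ` only quantifies over type 0 and type 1 objects. -/
def IsSigma21 (S : Set ℕ) : Prop :=
  ∃ (k : ℕ) (ψ : Arith.Formula k 1 0),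
    ∀ x : ℕ, x ∈ S ↔ ∃ X : Fin k → Type2, ψ.Holds X (fun _ => x) Fin.elim0

universe u

/-!
A satisfiable sentence has a model whose vertices are the type 1 objects, and such a model, together
with its satisfaction relation, is described by three type 2 objects.

*Small models.* Let `T` be a model. For every formula `∃π. φ` and every environment choose a
witnessing path, and for every vertex a successor. These are countably many Skolem functions, each
taking countably many vertices as arguments, so the vertices they generate from the initial one are
the values of countably branching well-founded trees with labels in `ℕ`. Such a tree is determined
by its labels at the addresses in `List ℕ`, hence there are only continuum many, and one obtains a
map `f : Type1 → T.Vertex` whose range is closed under the Skolem functions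
(`TransitionSystem.exists_covering`). Closing off under functions of infinite arity at once, by
well-founded trees, replaces an iteration of length `ω₁`. Pulling back edges and labels along `f`
preserves satisfaction: a path in the pullback maps to a path of `T`, and a witness in `T` lifts to
the pullback.

*Coding.* A system on `Type1` is given by type 2 objects `X 0` (edges) and `X 1` (labels), and `X 2`
assigns truth values to pairs of a formula code and an environment. As paths and environments are
countable arrays of numbers, they are again type 1 objects, so Tarski's recursive conditions on `X 2`
only quantify over types 0 and 1 (`CodedModel.IsTruthPredicate`). They determine `X 2` by induction
on formulas (`CodedModel.IsTruthPredicate.iff_sat`), and the pullback along `f` fulfils them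
(`CodedModel.isTruthPredicate_ofSystem`). Being the code of a sentence is likewise expressed by the
existence of type 1 tables obeying a recursion. Since `HyperCTL.code` is a bijection, all these
recursions may range over all numbers. The most recently assigned path is kept at index `0` of an
environment, all variables being assigned; for sentences this makes no difference
(`TransitionSystem.sat_congr`).

*Definability.* `Arith.Definable` and its variants for functions are closed under the logical
operations and under substitution, from which the conditions above are seen to be arithmetical.
-/

/-! ### Definability in arithmetic over type 2 parameters -/

namespace Arith

variable {k m n : ℕ}

/-- `P` is the truth set of a formula. Quantifying over all renamings `σ`, `τ` of the free
variables makes weakening a triviality and spares a renaming operation on the syntax. -/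
def Definable (P : (Fin k → Type2) → (Fin m → ℕ) → (Fin n → Type1) → Prop) : Prop :=
  ∀ ⦃m' n' : ℕ⦄ (σ : Fin m → Fin m') (τ : Fin n → Fin n'), ∃ φ : Formula k m' n',
    ∀ X x Y, φ.Holds X x Y ↔ P X (fun i => x (σ i)) (fun j => Y (τ j))

/-- The number-valued function `f` has a definable graph, the value being variable `0`. -/
def DefinableNum (f : (Fin k → Type2) → (Fin m → ℕ) → (Fin n → Type1) → ℕ) : Prop :=
  Definable (m := m + 1) fun X x Y => x 0 = f X (fun i => x i.succ) Y

/-- The function `F` with values in the type 1 objects is definable: its value at a further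
number variable is. -/
def DefinableFun (F : (Fin k → Type2) → (Fin m → ℕ) → (Fin n → Type1) → Type1) : Prop :=
  DefinableNum (m := m + 1) fun X x Y => F X (fun i => x i.succ) Y (x 0)

namespace Definable

theorem rename {m' n' : ℕ} {P : (Fin k → Type2) → (Fin m → ℕ) → (Fin n → Type1) → Prop}
    (h : Definable P) (s : Fin m → Fin m') (t : Fin n → Fin n') :
    Definable fun X x Y => P X (fun i => x (s i)) (fun j => Y (t j)) :=
  fun _ _ σ τ => h (fun i => σ (s i)) (fun j => τ (t j))

variable {P Q : (Fin k → Type2) → (Fin m → ℕ) → (Fin n → Type1) → Prop}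

theorem congr (h : Definable P) (e : ∀ X x Y, Q X x Y ↔ P X x Y) : Definable Q := by
  intro m' n' σ τ
  obtain ⟨φ, hφ⟩ := h σ τ
  exact ⟨φ, fun X x Y => (hφ X x Y).trans (e _ _ _).symm⟩

theorem not (h : Definable P) : Definable fun X x Y => ¬ P X x Y := by
  intro m' n' σ τ
  obtain ⟨φ, hφ⟩ := h σ τ
  exact ⟨.not φ, fun X x Y => not_congr (hφ X x Y)⟩

theorem and (hP : Definable P) (hQ : Definable Q) :
    Definable fun X x Y => P X x Y ∧ Q X x Y := by
  intro m' n' σ τ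
  obtain ⟨φ, hφ⟩ := hP σ τ
  obtain ⟨ψ, hψ⟩ := hQ σ τ
  exact ⟨.and φ ψ, fun X x Y => and_congr (hφ X x Y) (hψ X x Y)⟩

theorem or (hP : Definable P) (hQ : Definable Q) :
    Definable fun X x Y => P X x Y ∨ Q X x Y := by
  intro m' n' σ τ
  obtain ⟨φ, hφ⟩ := hP σ τ
  obtain ⟨ψ, hψ⟩ := hQ σ τ
  exact ⟨.or φ ψ, fun X x Y => or_congr (hφ X x Y) (hψ X x Y)⟩

theorem imp (hP : Definable P) (hQ : Definable Q) :
    Definable fun X x Y => P X x Y → Q X x Y :=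
  (hP.not.or hQ).congr fun _ _ _ => imp_iff_not_or

theorem iff (hP : Definable P) (hQ : Definable Q) :
    Definable fun X x Y => (P X x Y ↔ Q X x Y) :=
  ((hP.imp hQ).and (hQ.imp hP)).congr fun _ _ _ => iff_iff_implies_and_implies

theorem ex0 {P : (Fin k → Type2) → (Fin m → ℕ) → (Fin n → Type1) → ℕ → Prop}
    (h : Definable (m := m + 1) fun X x Y => P X (fun i => x i.succ) Y (x 0)) :
    Definable fun X x Y => ∃ a, P X x Y a := by
  intro m' n' σ τ
  obtain ⟨φ, hφ⟩ := h (Fin.cons 0 fun i => (σ i).succ) τ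
  exact ⟨.ex0 φ, fun X x Y => exists_congr fun a => hφ X (Fin.cons a x) Y⟩

theorem all0 {P : (Fin k → Type2) → (Fin m → ℕ) → (Fin n → Type1) → ℕ → Prop}
    (h : Definable (m := m + 1) fun X x Y => P X (fun i => x i.succ) Y (x 0)) :
    Definable fun X x Y => ∀ a, P X x Y a := by
  intro m' n' σ τ
  obtain ⟨φ, hφ⟩ := h (Fin.cons 0 fun i => (σ i).succ) τ
  exact ⟨.all0 φ, fun X x Y => forall_congr' fun a => hφ X (Fin.cons a x) Y⟩

theorem ex1 {P : (Fin k → Type2) → (Fin m → ℕ) → (Fin n → Type1) → Type1 → Prop}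
    (h : Definable (n := n + 1) fun X x Y => P X x (fun j => Y j.succ) (Y 0)) :
    Definable fun X x Y => ∃ B, P X x Y B := by
  intro m' n' σ τ
  obtain ⟨φ, hφ⟩ := h σ (Fin.cons 0 fun j => (τ j).succ)
  exact ⟨.ex1 φ, fun X x Y => exists_congr fun B => hφ X x (Fin.cons B Y)⟩

theorem all1 {P : (Fin k → Type2) → (Fin m → ℕ) → (Fin n → Type1) → Type1 → Prop}
    (h : Definable (n := n + 1) fun X x Y => P X x (fun j => Y j.succ) (Y 0)) :
    Definable fun X x Y => ∀ B, P X x Y B := by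
  intro m' n' σ τ
  obtain ⟨φ, hφ⟩ := h σ (Fin.cons 0 fun j => (τ j).succ)
  exact ⟨.all1 φ, fun X x Y => forall_congr' fun B => hφ X x (Fin.cons B Y)⟩

variable {f g : (Fin k → Type2) → (Fin m → ℕ) → (Fin n → Type1) → ℕ}

theorem subst0 {P : (Fin k → Type2) → (Fin m → ℕ) → (Fin n → Type1) → ℕ → Prop}
    (h : Definable (m := m + 1) fun X x Y => P X (fun i => x i.succ) Y (x 0))
    (hf : DefinableNum f) : Definable fun X x Y => P X x Y (f X x Y) :=
  (ex0 (P := fun X x Y a => a = f X x Y ∧ P X x Y a) (hf.and h)).congr fun _ _ _ => by simp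

/-- Arguments may be substituted into a definable binary relation of numbers. -/
theorem rel₂ {R : ℕ → ℕ → Prop}
    (h : Definable (k := k) (m := 2) (n := 0) fun _ x _ => R (x 0) (x 1))
    (hf : DefinableNum f) (hg : DefinableNum g) :
    Definable fun X x Y => R (f X x Y) (g X x Y) :=
  subst0 (P := fun X x Y a => R a (g X x Y))
    (subst0 (P := fun _ x _ b => R (x 0) b)
      (h.rename (Fin.cons 1 (Fin.cons 0 Fin.elim0)) Fin.elim0)
      (hg.rename (Fin.cons 0 fun i => i.succ.succ) id)) hf

theorem eq (hf : DefinableNum f) (hg : DefinableNum g) :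
    Definable fun X x Y => f X x Y = g X x Y :=
  subst0 (P := fun X x Y a => a = g X x Y) hg hf

theorem lt (hf : DefinableNum f) (hg : DefinableNum g) :
    Definable fun X x Y => f X x Y < g X x Y :=
  rel₂ (fun _ _ σ _ => ⟨.lt (.var (σ 0)) (.var (σ 1)), fun _ _ _ => Iff.rfl⟩) hf hg

theorem ne (hf : DefinableNum f) (hg : DefinableNum g) :
    Definable fun X x Y => f X x Y ≠ g X x Y :=
  (eq hf hg).not

end Definable

namespace DefinableNum

variable {f g : (Fin k → Type2) → (Fin m → ℕ) → (Fin n → Type1) → ℕ}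

theorem rename {m' n' : ℕ} (hf : DefinableNum f) (s : Fin m → Fin m') (t : Fin n → Fin n') :
    DefinableNum fun X x Y => f X (fun i => x (s i)) (fun j => Y (t j)) :=
  Definable.rename hf (Fin.cons 0 fun i => (s i).succ) t

theorem var (i : Fin m) : DefinableNum (k := k) (n := n) fun _ x _ => x i :=
  fun _ _ σ _ => ⟨.eq (.var (σ 0)) (.var (σ i.succ)), fun _ _ _ => Iff.rfl⟩

theorem comp₁ {op : ℕ → ℕ}
    (h : Definable (k := k) (m := 2) (n := 0) fun _ x _ => x 0 = op (x 1))
    (hf : DefinableNum f) : DefinableNum fun X x Y => op (f X x Y) :=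
  Definable.rel₂ (R := fun a b => a = op b) h (var 0) (hf.rename Fin.succ id)

theorem comp₂ {op : ℕ → ℕ → ℕ}
    (h : Definable (k := k) (m := 3) (n := 0) fun _ x _ => x 0 = op (x 1) (x 2))
    (hf : DefinableNum f) (hg : DefinableNum g) :
    DefinableNum fun X x Y => op (f X x Y) (g X x Y) :=
  Definable.subst0 (P := fun X x Y a => x 0 = op a (g X (fun i => x i.succ) Y))
    (Definable.subst0 (P := fun _ x _ b => x 1 = op (x 0) b)
      (h.rename (Fin.cons 2 (Fin.cons 1 (Fin.cons 0 Fin.elim0))) Fin.elim0)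
      (hg.rename (fun i => i.succ.succ) id))
    (hf.rename Fin.succ id)

theorem zero : DefinableNum (k := k) (m := m) (n := n) fun _ _ _ => 0 :=
  fun _ _ σ _ => ⟨.eq (.var (σ 0)) .zero, fun _ _ _ => Iff.rfl⟩

theorem one : DefinableNum (k := k) (m := m) (n := n) fun _ _ _ => 1 :=
  fun _ _ σ _ => ⟨.eq (.var (σ 0)) .one, fun _ _ _ => Iff.rfl⟩

theorem add (hf : DefinableNum f) (hg : DefinableNum g) :
    DefinableNum fun X x Y => f X x Y + g X x Y :=
  comp₂ (fun _ _ σ _ =>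
    ⟨.eq (.var (σ 0)) (.add (.var (σ 1)) (.var (σ 2))), fun _ _ _ => Iff.rfl⟩) hf hg

theorem mul (hf : DefinableNum f) (hg : DefinableNum g) :
    DefinableNum fun X x Y => f X x Y * g X x Y :=
  comp₂ (fun _ _ σ _ =>
    ⟨.eq (.var (σ 0)) (.mul (.var (σ 1)) (.var (σ 2))), fun _ _ _ => Iff.rfl⟩) hf hg

theorem const (c : ℕ) : DefinableNum (k := k) (m := m) (n := n) fun _ _ _ => c := by
  induction c with
  | zero => exact zero
  | succ c ih => exact ih.add one

theorem ite {P : (Fin k → Type2) → (Fin m → ℕ) → (Fin n → Type1) → Prop}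
    [∀ X x Y, Decidable (P X x Y)] (hP : Definable P) (hf : DefinableNum f)
    (hg : DefinableNum g) : DefinableNum fun X x Y => if P X x Y then f X x Y else g X x Y := by
  have hP' := hP.rename Fin.succ (id : Fin n → Fin n)
  refine ((hP'.and hf).or (hP'.not.and hg)).congr fun X x Y => ?_
  by_cases h : P X (fun i => x i.succ) Y <;> simp [h]

theorem pair (hf : DefinableNum f) (hg : DefinableNum g) :
    DefinableNum fun X x Y => Nat.pair (f X x Y) (g X x Y) :=
  comp₂ (Definable.eq (var 0) (ite (Definable.lt (var 1) (var 2)) (((var 2).mul (var 2)).add (var 1))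
    ((((var 1).mul (var 1)).add (var 1)).add (var 2)))) hf hg

theorem unpair_fst (hf : DefinableNum f) : DefinableNum fun X x Y => (f X x Y).unpair.1 :=
  comp₁ (op := fun a => a.unpair.1)
    ((Definable.ex0 (P := fun _ x _ b => x 1 = Nat.pair (x 0) b)
      (.eq (var 2) ((var 1).pair (var 0)))).congr fun X x Y =>
        ⟨fun h => ⟨(x 1).unpair.2, by simp [h]⟩, fun ⟨b, h⟩ => by simp [h]⟩) hf

theorem unpair_snd (hf : DefinableNum f) : DefinableNum fun X x Y => (f X x Y).unpair.2 :=
  comp₁ (op := fun a => a.unpair.2)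
    ((Definable.ex0 (P := fun _ x _ b => x 1 = Nat.pair b (x 0))
      (.eq (var 2) ((var 0).pair (var 1)))).congr fun X x Y =>
        ⟨fun h => ⟨(x 1).unpair.1, by simp [h]⟩, fun ⟨b, h⟩ => by simp [h]⟩) hf

theorem app1 {F : (Fin k → Type2) → (Fin m → ℕ) → (Fin n → Type1) → Type1}
    (hF : DefinableFun F) (hf : DefinableNum f) :
    DefinableNum fun X x Y => F X x Y (f X x Y) := by
  have hF' : Definable (k := k) (m := m + 2) (n := n) fun X x Y =>
    x 0 = F X (fun i => x i.succ.succ) Y (x 1) := hF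
  exact Definable.subst0 (P := fun X x Y a => x 0 = F X (fun i => x i.succ) Y a)
    (hF'.rename (Fin.cons 1 (Fin.cons 0 fun i => i.succ.succ)) id) (hf.rename Fin.succ id)

theorem var_app (j : Fin n) (hf : DefinableNum f) : DefinableNum fun X x Y => Y j (f X x Y) :=
  app1 (F := fun _ _ Y => Y j)
    (fun _ _ σ τ => ⟨.eq (.var (σ 0)) (.app1 (τ j) (.var (σ 1))), fun _ _ _ => Iff.rfl⟩) hf

theorem app2 {F : (Fin k → Type2) → (Fin m → ℕ) → (Fin n → Type1) → Type1}
    (i : Fin k) (hF : DefinableFun F) : DefinableNum fun X x Y => X i (F X x Y) := by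
  have h : Definable (k := k) (m := m + 1) (n := n) fun X x Y =>
      ∃ B : Type1, (∀ a, B a = F X (fun i => x i.succ) Y a) ∧ x 0 = X i B := by
    refine .ex1 (.and (.all0 (Definable.eq ?_ ?_)) ?_)
    · exact fun _ _ σ τ => ⟨.eq (.var (σ 0)) (.app1 (τ 0) (.var (σ 1))), fun _ _ _ => Iff.rfl⟩
    · exact DefinableNum.rename hF (Fin.cons 0 fun i => i.succ.succ) Fin.succ
    · exact fun _ _ σ τ => ⟨.eq (.var (σ 0)) (.app2 i (τ 0)), fun _ _ _ => Iff.rfl⟩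
  refine h.congr fun X x Y => ⟨fun h => ⟨_, fun _ => rfl, h⟩, ?_⟩
  rintro ⟨B, hB, h⟩
  exact h.trans (congrArg (X i) (funext hB))

end DefinableNum

theorem DefinableFun.var (j : Fin n) : DefinableFun (k := k) (m := m) fun _ _ Y => Y j :=
  fun _ _ σ τ => ⟨.eq (.var (σ 0)) (.app1 (τ j) (.var (σ 1))), fun _ _ _ => Iff.rfl⟩

theorem DefinableFun.lam {f : (Fin k → Type2) → (Fin m → ℕ) → (Fin n → Type1) → ℕ → ℕ}
    (hf : DefinableNum (m := m + 1) fun X x Y => f X (fun i => x i.succ) Y (x 0)) :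
    DefinableFun fun X x Y a => f X x Y a :=
  hf

end Arith

/-! ### Codes of formulas and of sentences -/

namespace HyperCTL

theorem code_surjective : Function.Surjective code := by
  intro n
  induction n using Nat.strong_induction_on with
  | _ n ih =>
    have hdiv : 7 * (n / 7) + n % 7 = n := Nat.div_add_mod n 7
    have hlt : n % 7 < 7 := Nat.mod_lt _ (by norm_num)
    have hfst := Nat.unpair_left_le (n / 7)
    have hsnd := Nat.unpair_right_le (n / 7)
    have hpair := Nat.pair_unpair (n / 7)
    generalize n / 7 = q at *
    generalize n % 7 = r at *
    -- for `r ≠ 0` the quotient `q`, and with it both components of `q.unpair`, is below `n`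
    obtain rfl | hr := Nat.eq_zero_or_pos r
    · exact ⟨atom q.unpair.1 q.unpair.2, by simp only [code]; omega⟩
    obtain ⟨φ, hφ⟩ := ih q (by omega)
    obtain ⟨φ₁, hφ₁⟩ := ih q.unpair.1 (by omega)
    obtain ⟨φ₂, hφ₂⟩ := ih q.unpair.2 (by omega)
    interval_cases r
    · exact ⟨neg φ, by simp only [code, hφ]; omega⟩
    · exact ⟨or φ₁ φ₂, by simp only [code, hφ₁, hφ₂, hpair]; omega⟩
    · exact ⟨next φ, by simp only [code, hφ]; omega⟩
    · exact ⟨untl φ₁ φ₂, by simp only [code, hφ₁, hφ₂, hpair]; omega⟩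
    · exact ⟨ex q.unpair.1 φ₂, by simp only [code, hφ₂, hpair]; omega⟩
    · exact ⟨all q.unpair.1 φ₂, by simp only [code, hφ₂, hpair]; omega⟩

/-- Every number is the code of exactly one formula. -/
noncomputable def codeEquiv : HyperCTL ≃ ℕ :=
  Equiv.ofBijective code ⟨code_injective, code_surjective⟩

@[simp] theorem codeEquiv_symm_code (φ : HyperCTL) : codeEquiv.symm φ.code = φ :=
  codeEquiv.symm_apply_apply φ

/-- The recursion that determines the free variables of a formula from its code: `F` is nonzero
at `Nat.pair n q` iff `q` is free in the formula with code `n`. -/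
def IsFreeTable (F : Type1) : Prop :=
  ∀ a b q : ℕ,
    (F (Nat.pair (7 * Nat.pair a b) q) ≠ 0 ↔ q = b) ∧
    (F (Nat.pair (7 * a + 1) q) ≠ 0 ↔ F (Nat.pair a q) ≠ 0) ∧
    (F (Nat.pair (7 * Nat.pair a b + 2) q) ≠ 0 ↔
      F (Nat.pair a q) ≠ 0 ∨ F (Nat.pair b q) ≠ 0) ∧
    (F (Nat.pair (7 * a + 3) q) ≠ 0 ↔ F (Nat.pair a q) ≠ 0) ∧
    (F (Nat.pair (7 * Nat.pair a b + 4) q) ≠ 0 ↔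
      F (Nat.pair a q) ≠ 0 ∨ F (Nat.pair b q) ≠ 0) ∧
    (F (Nat.pair (7 * Nat.pair a b + 5) q) ≠ 0 ↔ F (Nat.pair b q) ≠ 0 ∧ q ≠ a) ∧
    (F (Nat.pair (7 * Nat.pair a b + 6) q) ≠ 0 ↔ F (Nat.pair b q) ≠ 0 ∧ q ≠ a)

/-- The recursion that determines from its code whether a formula is guarded. -/
def IsGuardTable (G : Type1) : Prop :=
  ∀ a b : ℕ,
    G (7 * Nat.pair a b) ≠ 0 ∧
    (G (7 * a + 1) ≠ 0 ↔ G a ≠ 0) ∧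
    (G (7 * Nat.pair a b + 2) ≠ 0 ↔ G a ≠ 0 ∧ G b ≠ 0) ∧
    G (7 * a + 3) = 0 ∧
    G (7 * Nat.pair a b + 4) = 0 ∧
    G (7 * Nat.pair a b + 5) ≠ 0 ∧
    G (7 * Nat.pair a b + 6) ≠ 0

theorem IsFreeTable.iff_mem_freeVars {F : Type1} (hF : IsFreeTable F) (φ : HyperCTL) (q : ℕ) :
    F (Nat.pair φ.code q) ≠ 0 ↔ q ∈ φ.freeVars := by
  induction φ with
  | atom a π => exact (hF a π q).1
  | neg φ ih => exact (hF φ.code 0 q).2.1.trans ih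
  | or φ ψ ih ih' => exact (hF φ.code ψ.code q).2.2.1.trans (or_congr ih ih')
  | next φ ih => exact (hF φ.code 0 q).2.2.2.1.trans ih
  | untl φ ψ ih ih' => exact (hF φ.code ψ.code q).2.2.2.2.1.trans (or_congr ih ih')
  | ex π φ ih => exact (hF π φ.code q).2.2.2.2.2.1.trans (and_congr ih Iff.rfl)
  | all π φ ih => exact (hF π φ.code q).2.2.2.2.2.2.trans (and_congr ih Iff.rfl)

theorem IsGuardTable.iff_guarded {G : Type1} (hG : IsGuardTable G) (φ : HyperCTL) :
    G φ.code ≠ 0 ↔ φ.Guarded := by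
  induction φ with
  | atom a π => exact iff_of_true (hG a π).1 trivial
  | neg φ ih => exact (hG φ.code 0).2.1.trans ih
  | or φ ψ ih ih' => exact (hG φ.code ψ.code).2.2.1.trans (and_congr ih ih')
  | next φ ih => exact iff_of_false (not_not.2 (hG φ.code 0).2.2.2.1) id
  | untl φ ψ ih ih' => exact iff_of_false (not_not.2 (hG φ.code ψ.code).2.2.2.2.1) id
  | ex π φ ih => exact iff_of_true (hG π φ.code).2.2.2.2.2.1 trivial
  | all π φ ih => exact iff_of_true (hG π φ.code).2.2.2.2.2.2 trivial

open Classical in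
theorem exists_isFreeTable : ∃ F, IsFreeTable F := by
  refine ⟨fun i => if i.unpair.2 ∈ (codeEquiv.symm i.unpair.1).freeVars then 1 else 0,
    fun a b q => ?_⟩
  obtain ⟨φ, rfl⟩ := code_surjective a
  obtain ⟨ψ, rfl⟩ := code_surjective b
  have h1 := codeEquiv_symm_code (atom φ.code ψ.code)
  have h2 := codeEquiv_symm_code (neg φ)
  have h3 := codeEquiv_symm_code (or φ ψ)
  have h4 := codeEquiv_symm_code (next φ)
  have h5 := codeEquiv_symm_code (untl φ ψ)
  have h6 := codeEquiv_symm_code (ex φ.code ψ)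
  have h7 := codeEquiv_symm_code (all φ.code ψ)
  simp only [code] at h1 h2 h3 h4 h5 h6 h7
  simp [h1, h2, h3, h4, h5, h6, h7, freeVars, or_iff_not_imp_left]

open Classical in
theorem exists_isGuardTable : ∃ G, IsGuardTable G := by
  refine ⟨fun i => if (codeEquiv.symm i).Guarded then 1 else 0, fun a b => ?_⟩
  obtain ⟨φ, rfl⟩ := code_surjective a
  obtain ⟨ψ, rfl⟩ := code_surjective b
  have h1 := codeEquiv_symm_code (atom φ.code ψ.code)
  have h2 := codeEquiv_symm_code (neg φ)
  have h3 := codeEquiv_symm_code (or φ ψ)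
  have h4 := codeEquiv_symm_code (next φ)
  have h5 := codeEquiv_symm_code (untl φ ψ)
  have h6 := codeEquiv_symm_code (ex φ.code ψ)
  have h7 := codeEquiv_symm_code (all φ.code ψ)
  simp only [code] at h1 h2 h3 h4 h5 h6 h7
  simp [h1, h2, h3, h4, h5, h6, h7, Guarded]

end HyperCTL

namespace TransitionSystem

variable {T : TransitionSystem.{u}}

/-! ### Total environments -/

/-- The assignment in which all path variables are assigned: `e (π + 1)` is the path of `π`, and
`e 0` is the most recently assigned path. -/
def Assignment.ofEnv (e : ℕ → ℕ → T.Vertex) : T.Assignment :=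
  ⟨fun π => some (e (π + 1)), some (e 0)⟩

/-- The truth value of a formula only depends on the paths of its free variables and on the most recent
path; for a guarded formula the first vertex of the latter suffices, as no temporal operator is
evaluated before the next quantifier. -/
theorem sat_congr (φ : HyperCTL) (A B : T.Assignment)
    (hpath : ∀ π ∈ φ.freeVars, A.path π = B.path π)
    (hrecent : A.recent = B.recent ∨ φ.Guarded ∧ A.rcnt = B.rcnt) :
    T.Sat φ A ↔ T.Sat φ B := by
  have hrcnt : ∀ A B : T.Assignment, A.recent = B.recent → A.rcnt = B.rcnt := by
    intro A B h
    simp only [Assignment.rcnt, h]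
  have hsuffix : ∀ (s : Set ℕ) (A B : T.Assignment) (j : ℕ), (∀ π ∈ s, A.path π = B.path π) →
      ∀ π ∈ s, (A.suffix j).path π = (B.suffix j).path π := by
    intro s A B j h π hπ
    simp only [Assignment.suffix, h π hπ]
  have hsuffix' : ∀ (A B : T.Assignment) (j : ℕ), A.recent = B.recent →
      (A.suffix j).recent = (B.suffix j).recent := by
    intro A B j h
    simp only [Assignment.suffix, h]
  have hupdate : ∀ (s : Set ℕ) (A B : T.Assignment) (π : ℕ) (ρ : ℕ → T.Vertex),
      (∀ q ∈ s \ {π}, A.path q = B.path q) →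
      ∀ q ∈ s, (A.update π ρ).path q = (B.update π ρ).path q := by
    intro s A B π ρ h q hq
    by_cases hqπ : q = π
    · subst hqπ
      simp [Assignment.update]
    · simpa [Assignment.update, Function.update_of_ne hqπ] using h q ⟨hq, hqπ⟩
  induction φ generalizing A B with
  | atom a π => simp only [Sat, hpath π rfl]
  | neg φ ih => exact not_congr (ih A B hpath hrecent)
  | or φ ψ ih ih' =>
    exact or_congr
      (ih A B (fun π h => hpath π (.inl h)) (hrecent.imp_right fun h => ⟨h.1.1, h.2⟩))
      (ih' A B (fun π h => hpath π (.inr h)) (hrecent.imp_right fun h => ⟨h.1.2, h.2⟩))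
  | next φ ih =>
    have hrecent := hrecent.resolve_right fun h => h.1
    exact ih _ _ (hsuffix _ A B 1 hpath) (.inl (hsuffix' A B 1 hrecent))
  | untl φ ψ ih ih' =>
    have hrecent := hrecent.resolve_right fun h => h.1
    exact exists_congr fun j => and_congr
      (ih' _ _ (hsuffix _ A B j fun π h => hpath π (.inr h)) (.inl (hsuffix' A B j hrecent)))
      (forall₂_congr fun i _ =>
        ih _ _ (hsuffix _ A B i fun π h => hpath π (.inl h)) (.inl (hsuffix' A B i hrecent)))
  | ex π φ ih =>
    simp only [Sat, hrecent.elim (hrcnt A B) And.right]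
    exact exists_congr fun ρ => and_congr_right fun _ => and_congr_right fun _ =>
      ih _ _ (hupdate _ A B π ρ hpath) (.inl rfl)
  | all π φ ih =>
    simp only [Sat, hrecent.elim (hrcnt A B) And.right]
    exact forall_congr' fun ρ => imp_congr_right fun _ => imp_congr_right fun _ =>
      ih _ _ (hupdate _ A B π ρ hpath) (.inl rfl)

theorem models_iff_sat_ofEnv {φ : HyperCTL} (hφ : φ.IsSentence) (e : ℕ → ℕ → T.Vertex)
    (he : e 0 0 = T.init) : T.Models φ ↔ T.Sat φ (Assignment.ofEnv e) :=
  sat_congr φ _ _ (by simp [hφ.1]) (.inr ⟨hφ.2, he.symm⟩)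

/-! ### Models of the cardinality of the continuum -/

/-- The environment in which the path of `π` and the most recent path are replaced by `ρ`. -/
def envUpdate {V : Type*} (e : ℕ → ℕ → V) (π : ℕ) (ρ : ℕ → V) : ℕ → ℕ → V :=
  fun k => if k = 0 ∨ k = π + 1 then ρ else e k

theorem Assignment.ofEnv_update (e : ℕ → ℕ → T.Vertex) (π : ℕ) (ρ : ℕ → T.Vertex) :
    (ofEnv e).update π ρ = ofEnv (envUpdate e π ρ) := by
  simp only [ofEnv, update, envUpdate, true_or, if_true, Assignment.mk.injEq, and_true]
  funext q
  by_cases h : q = π <;> simp [h]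

/-- Countably branching well-founded trees with inner nodes labelled by numbers. They serve as
terms over countably many Skolem functions of countable arity. -/
inductive Tree : Type
  | root : Tree
  | node (a : ℕ) (c : ℕ → Tree) : Tree

namespace Tree

/-- The label of a tree at an address, shifted by one; it is `0` at leaves and off the tree. -/
def labelAt : Tree → List ℕ → ℕ
  | root, _ => 0
  | node a _, [] => a + 1
  | node _ c, i :: l => (c i).labelAt l

theorem labelAt_injective : Function.Injective labelAt := by
  intro s
  induction s with
  | root =>
    rintro (_ | ⟨a, c⟩) h
    · rfl
    · exact absurd (congrFun h []) (Nat.succ_ne_zero a).symm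
  | node a c ih =>
    rintro (_ | ⟨b, d⟩) h
    · exact absurd (congrFun h []) (Nat.succ_ne_zero a)
    · have hab : a = b := Nat.succ.inj (congrFun h [])
      have hcd : c = d := funext fun i => ih i (funext fun l => congrFun h (i :: l))
      rw [hab, hcd]

instance : Nonempty Tree := ⟨root⟩

/-- There are at most continuum many trees. -/
theorem exists_surjective : ∃ g : Type1 → Tree, Function.Surjective g := by
  have h : Function.Injective fun (t : Tree) (i : ℕ) =>
      t.labelAt (Denumerable.ofNat (List ℕ) i) := by
    intro s t hst
    refine labelAt_injective (funext fun l => ?_)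
    simpa using congrFun hst (Encodable.encode l)
  exact ⟨_, Function.invFun_surjective h⟩

end Tree

open Classical in
/-- Every transition system is covered by `Type1` in such a way that existential quantifiers and
edges can be lifted along the covering: the range of `f` is closed under Skolem functions that
pick, for a formula and an environment, a witnessing path, and for a vertex a successor. -/
theorem exists_covering (T : TransitionSystem.{u}) : ∃ f : Type1 → T.Vertex,
    T.init ∈ Set.range f ∧
    (∀ v w, T.Edge (f v) w → ∃ w', T.Edge (f v) (f w')) ∧
    ∀ (φ : HyperCTL) (π : ℕ) (e : ℕ → ℕ → Type1),
      T.Sat (.ex π φ) (Assignment.ofEnv fun k n => f (e k n)) →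
      ∃ R : ℕ → Type1, R 0 = e 0 0 ∧ T.IsPath (fun n => f (R n)) ∧
        T.Sat φ (Assignment.ofEnv (envUpdate (fun k n => f (e k n)) π fun n => f (R n))) := by
  have : Nonempty T.Vertex := ⟨T.init⟩
  let succ : T.Vertex → T.Vertex := fun v => epsilon fun w => T.Edge v w
  let wit : HyperCTL → ℕ → (ℕ → ℕ → T.Vertex) → ℕ → T.Vertex := fun φ π e =>
    epsilon fun ρ => T.IsPath ρ ∧ ρ 0 = e 0 0 ∧ T.Sat φ (Assignment.ofEnv (envUpdate e π ρ))
  -- label `0` takes a successor of the first child; label `Nat.pair φ (Nat.pair π n) + 1` takes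
  -- position `n` of the witness for `∃ π. φ` in the environment formed by the children
  let step : ℕ → (ℕ → T.Vertex) → T.Vertex := fun a c => a.casesOn (succ (c 0)) fun b =>
    wit (HyperCTL.codeEquiv.symm b.unpair.1) b.unpair.2.unpair.1 (fun k n => c (Nat.pair k n))
      b.unpair.2.unpair.2
  let val : Tree → T.Vertex := Tree.rec T.init fun a _ c => step a c
  obtain ⟨g, hg⟩ := Tree.exists_surjective
  choose s hs using hg
  refine ⟨fun v => val (g v), ⟨s .root, by simp only [hs]; rfl⟩, fun v w h => ?_, fun φ π e h => ?_⟩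
  · refine ⟨s (.node 0 fun _ => g v), ?_⟩
    simp only [hs]
    exact epsilon_spec (p := fun w => T.Edge (val (g v)) w) ⟨w, h⟩
  · obtain ⟨ρ₀, h₁, h₂, h₃⟩ := h
    rw [Assignment.ofEnv_update] at h₃
    set e' : ℕ → ℕ → T.Vertex := fun k n => val (g (e k n)) with he'
    have hspec : T.IsPath (wit φ π e') ∧ wit φ π e' 0 = e' 0 0 ∧
        T.Sat φ (Assignment.ofEnv (envUpdate e' π (wit φ π e'))) :=
      epsilon_spec (p := fun ρ => T.IsPath ρ ∧ ρ 0 = e' 0 0 ∧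
        T.Sat φ (Assignment.ofEnv (envUpdate e' π ρ))) ⟨ρ₀, h₁, h₂, h₃⟩
    -- position `0` is not a fresh tree, as the path has to start in the given vertex of `Type1`
    let R : ℕ → Type1 := fun n => n.casesOn (e 0 0) fun n =>
      s (.node (Nat.pair φ.code (Nat.pair π (n + 1)) + 1)
        fun i => g (e i.unpair.1 i.unpair.2))
    have hR : (fun n => val (g (R n))) = wit φ π e' := by
      funext n
      cases n with
      | zero => exact hspec.2.1.symm
      | succ n =>
        have : val (g (R (n + 1))) = val (.node (Nat.pair φ.code (Nat.pair π (n + 1)) + 1)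
          fun i => g (e i.unpair.1 i.unpair.2)) := congrArg val (hs _)
        rw [this]
        show wit (HyperCTL.codeEquiv.symm (Nat.unpair _).1) _
          (fun k n => val (g (e (Nat.unpair (Nat.pair k n)).1 (Nat.unpair (Nat.pair k n)).2))) _ = _
        simp [he']
    refine ⟨R, rfl, ?_, ?_⟩
    · rw [hR]; exact hspec.1
    · rw [hR]; exact hspec.2.2

end TransitionSystem

/-! ### Coding transition systems on `Type1` by type 2 objects -/

namespace CodedModel

open TransitionSystem

/-- The sequence of vertices coded by a type 1 object. -/
def pathOf (R : Type1) : ℕ → Type1 :=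
  fun n i => R (Nat.pair n i)

/-- The environment coded by a type 1 object. -/
def envOf (B : Type1) : ℕ → ℕ → Type1 :=
  fun k n i => B (Nat.pair k (Nat.pair n i))

/-- The code of a pair of a number and a type 1 object. -/
def tag (a : ℕ) (B : Type1) : Type1 :=
  fun i => Nat.pair a (B i)

/-- The code of a pair of type 1 objects. -/
def join (v w : Type1) : Type1 :=
  fun i => Nat.pair (v i) (w i)

/-- The suffix operation on coded environments. -/
def shift (j : ℕ) (B : Type1) : Type1 :=
  fun i => B (Nat.pair i.unpair.1 (Nat.pair (i.unpair.2.unpair.1 + j) i.unpair.2.unpair.2))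

/-- The update operation on coded environments. -/
def update (B : Type1) (π : ℕ) (R : Type1) : Type1 :=
  fun i => if i.unpair.1 = 0 ∨ i.unpair.1 = π + 1 then R i.unpair.2 else B i

/-- A code of the environment all of whose paths stay in `v`. -/
def constEnv (v : Type1) : Type1 :=
  fun i => v i.unpair.2.unpair.2

theorem pathOf_surjective : Function.Surjective pathOf := fun ρ =>
  ⟨fun i => ρ i.unpair.1 i.unpair.2, by funext n i; simp [pathOf]⟩

theorem envOf_shift (j : ℕ) (B : Type1) : envOf (shift j B) = fun k n => envOf B k (n + j) := by
  funext k n i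
  simp [envOf, shift]

theorem envOf_update (B : Type1) (π : ℕ) (R : Type1) :
    envOf (update B π R) = envUpdate (envOf B) π (pathOf R) := by
  funext k n i
  by_cases h : k = 0 ∨ k = π + 1 <;> simp [envOf, update, envUpdate, pathOf, h]

theorem envOf_constEnv (v : Type1) : envOf (constEnv v) = fun _ _ => v := by
  funext k n i
  simp [envOf, constEnv]

theorem tag_inj {a b : ℕ} {B C : Type1} (h : tag a B = tag b C) : a = b ∧ B = C :=
  ⟨(Nat.pair_eq_pair.1 (congrFun h 0)).1, funext fun i => (Nat.pair_eq_pair.1 (congrFun h i)).2⟩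

theorem join_inj {v w v' w' : Type1} (h : join v w = join v' w') : v = v' ∧ w = w' :=
  ⟨funext fun i => (Nat.pair_eq_pair.1 (congrFun h i)).1,
    funext fun i => (Nat.pair_eq_pair.1 (congrFun h i)).2⟩

/-- `R` codes a path through the transition system with edge relation `X 0`. -/
def IsPath (X : Fin 3 → Type2) (R : Type1) : Prop :=
  ∀ n, X 0 (join (pathOf R n) (pathOf R (n + 1))) ≠ 0

/-- Truth, according to `X 2`, of the formula with code `p` in the environment coded by `B`. -/
def IsTrue (X : Fin 3 → Type2) (p : ℕ) (B : Type1) : Prop :=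
  X 2 (tag p B) ≠ 0

/-- Tarski's recursive conditions: `X 2` is a truth predicate for the transition system on `Type1`
with edge relation `X 0` and labelling `X 1`. -/
def IsTruthPredicate (X : Fin 3 → Type2) : Prop :=
  ∀ (a b : ℕ) (B : Type1),
    (IsTrue X (7 * Nat.pair a b) B ↔ X 1 (tag a (envOf B (b + 1) 0)) ≠ 0) ∧
    (IsTrue X (7 * a + 1) B ↔ ¬ IsTrue X a B) ∧
    (IsTrue X (7 * Nat.pair a b + 2) B ↔ IsTrue X a B ∨ IsTrue X b B) ∧
    (IsTrue X (7 * a + 3) B ↔ IsTrue X a (shift 1 B)) ∧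
    (IsTrue X (7 * Nat.pair a b + 4) B ↔
      ∃ j, IsTrue X b (shift j B) ∧ ∀ i, i < j → IsTrue X a (shift i B)) ∧
    (IsTrue X (7 * Nat.pair a b + 5) B ↔
      ∃ R, IsPath X R ∧ (∀ i, pathOf R 0 i = envOf B 0 0 i) ∧ IsTrue X b (update B a R)) ∧
    (IsTrue X (7 * Nat.pair a b + 6) B ↔
      ∀ R, IsPath X R → (∀ i, pathOf R 0 i = envOf B 0 0 i) → IsTrue X b (update B a R))

/-- Every vertex has a successor under the edge relation `X 0`. -/
def IsTotal (X : Fin 3 → Type2) : Prop :=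
  ∀ v, ∃ w, X 0 (join v w) ≠ 0

/-- `x` is the code of a sentence. -/
def IsSentenceCode (x : ℕ) : Prop :=
  (∃ F, HyperCTL.IsFreeTable F ∧ ∀ q, F (Nat.pair x q) = 0) ∧
    ∃ G, HyperCTL.IsGuardTable G ∧ G x ≠ 0

theorem isSentenceCode_code (φ : HyperCTL) : IsSentenceCode φ.code ↔ φ.IsSentence := by
  refine and_congr ⟨?_, fun h => ?_⟩ ⟨?_, fun h => ?_⟩
  · rintro ⟨F, hF, h⟩
    exact Set.eq_empty_of_forall_notMem fun q hq => (hF.iff_mem_freeVars φ q).2 hq (h q)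
  · obtain ⟨F, hF⟩ := HyperCTL.exists_isFreeTable
    refine ⟨F, hF, fun q => not_not.1 fun hq => ?_⟩
    simpa [h] using (hF.iff_mem_freeVars φ q).1 hq
  · rintro ⟨G, hG, h⟩
    exact (hG.iff_guarded φ).1 h
  · obtain ⟨G, hG⟩ := HyperCTL.exists_isGuardTable
    exact ⟨G, hG, (hG.iff_guarded φ).2 h⟩

theorem ofEnv_envOf_update {T : TransitionSystem.{u}} (f : Type1 → T.Vertex) (B : Type1) (π : ℕ)
    (R : Type1) : (Assignment.ofEnv fun k n => f (envOf (update B π R) k n)) =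
      (Assignment.ofEnv fun k n => f (envOf B k n)).update π fun n => f (pathOf R n) := by
  rw [envOf_update, Assignment.ofEnv_update]
  congr 1
  funext k n
  by_cases h : k = 0 ∨ k = π + 1 <;> simp [envUpdate, h]

theorem ofEnv_envOf_shift {T : TransitionSystem.{u}} (f : Type1 → T.Vertex) (j : ℕ) (B : Type1) :
    (Assignment.ofEnv fun k n => f (envOf (shift j B) k n)) =
      (Assignment.ofEnv fun k n => f (envOf B k n)).suffix j := by
  rw [envOf_shift]
  rfl

/-- If `X 0` and `X 1` code `T` along a bijection, then a truth predicate `X 2` is the truth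
predicate of `T`. -/
theorem IsTruthPredicate.iff_sat {X : Fin 3 → Type2} (hX : IsTruthPredicate X)
    {T : TransitionSystem.{u}} (g : Type1 ≃ T.Vertex)
    (hedge : ∀ v w, X 0 (join v w) ≠ 0 ↔ T.Edge (g v) (g w))
    (hlabel : ∀ a v, X 1 (tag a v) ≠ 0 ↔ a ∈ T.label (g v)) (φ : HyperCTL) (B : Type1) :
    IsTrue X φ.code B ↔ T.Sat φ (Assignment.ofEnv fun k n => g (envOf B k n)) := by
  have hquant : ∀ {P : (ℕ → T.Vertex) → Prop} (B : Type1),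
      (∃ R, IsPath X R ∧ (∀ i, pathOf R 0 i = envOf B 0 0 i) ∧ P fun n => g (pathOf R n)) ↔
      ∃ ρ, T.IsPath ρ ∧ ρ 0 = g (envOf B 0 0) ∧ P ρ := by
    intro P B
    constructor
    · rintro ⟨R, h₁, h₂, h₃⟩
      exact ⟨_, fun n => (hedge _ _).1 (h₁ n), congrArg g (funext h₂), h₃⟩
    · rintro ⟨ρ, h₁, h₂, h₃⟩
      obtain ⟨R, hR⟩ := pathOf_surjective fun n => g.symm (ρ n)
      have hρ : (fun n => g (pathOf R n)) = ρ := by simp [hR]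
      refine ⟨R, fun n => (hedge _ _).2 ?_, fun i => ?_, ?_⟩
      · simpa [hR] using h₁ n
      · simp [hR, h₂]
      · rwa [hρ]
  induction φ generalizing B with
  | atom a π =>
    refine (hX a π B).1.trans ((hlabel _ _).trans ⟨fun h => ⟨_, rfl, h⟩, ?_⟩)
    rintro ⟨_, ⟨⟩, h⟩
    exact h
  | neg φ ih => exact (hX φ.code 0 B).2.1.trans (not_congr (ih B))
  | or φ ψ ih ih' => exact (hX φ.code ψ.code B).2.2.1.trans (or_congr (ih B) (ih' B))
  | next φ ih =>
    simp only [Sat, ← ofEnv_envOf_shift, ← ih]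
    exact (hX φ.code 0 B).2.2.2.1
  | untl φ ψ ih ih' =>
    simp only [Sat, ← ofEnv_envOf_shift, ← ih, ← ih']
    exact (hX φ.code ψ.code B).2.2.2.2.1
  | ex π φ ih =>
    refine (hX π φ.code B).2.2.2.2.2.1.trans (Iff.trans ?_ (hquant B))
    simp only [← ofEnv_envOf_update, ih]
  | all π φ ih =>
    refine (hX π φ.code B).2.2.2.2.2.2.trans (not_iff_not.1 ?_)
    have := hquant (P := fun ρ => ¬ T.Sat φ
      ((Assignment.ofEnv fun k n => g (envOf B k n)).update π ρ)) B
    simp only [← ofEnv_envOf_update, ← ih] at this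
    simp only [Sat, not_forall, exists_prop]
    exact this

/-- The transition system on (a copy in any universe of) `Type1` coded by `X`. -/
def toSystem (X : Fin 3 → Type2) (v : Type1) : TransitionSystem.{u} where
  Vertex := ULift.{u} Type1
  Edge a b := X 0 (join a.down b.down) ≠ 0
  init := ⟨v⟩
  label a := {p | X 1 (tag p a.down) ≠ 0}

theorem IsTruthPredicate.models_toSystem_iff {X : Fin 3 → Type2} (hX : IsTruthPredicate X)
    (v : Type1) {φ : HyperCTL} (hφ : φ.IsSentence) :
    (toSystem.{u} X v).Models φ ↔ IsTrue X φ.code (constEnv v) := by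
  rw [models_iff_sat_ofEnv hφ (fun k n => ULift.up (envOf (constEnv v) k n))
    (by rw [envOf_constEnv]; rfl)]
  exact (hX.iff_sat (T := toSystem.{u} X v) Equiv.ulift.symm (fun _ _ => Iff.rfl)
    (fun _ _ => Iff.rfl) φ _).symm

open Classical in
/-- The type 2 objects that describe the pullback of a transition system along `f`. -/
noncomputable def ofSystem (T : TransitionSystem.{u}) (f : Type1 → T.Vertex) : Fin 3 → Type2 :=
  ![fun Y => if ∃ v w, Y = join v w ∧ T.Edge (f v) (f w) then 1 else 0,
    fun Y => if ∃ a v, Y = tag a v ∧ a ∈ T.label (f v) then 1 else 0,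
    fun Y => if ∃ (φ : HyperCTL) (B : Type1), Y = tag φ.code B ∧
      T.Sat φ (Assignment.ofEnv fun k n => f (envOf B k n)) then 1 else 0]

section ofSystem

variable {T : TransitionSystem.{u}} {f : Type1 → T.Vertex}

theorem ofSystem_edge (v w : Type1) :
    ofSystem T f 0 (join v w) ≠ 0 ↔ T.Edge (f v) (f w) := by
  simp only [ofSystem, Matrix.cons_val_zero, ne_eq, ite_eq_right_iff, one_ne_zero, imp_false,
    not_not]
  refine ⟨?_, fun h => ⟨v, w, rfl, h⟩⟩
  rintro ⟨v', w', h, h'⟩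
  obtain ⟨rfl, rfl⟩ := join_inj h
  exact h'

theorem ofSystem_label (a : ℕ) (v : Type1) :
    ofSystem T f 1 (tag a v) ≠ 0 ↔ a ∈ T.label (f v) := by
  simp only [ofSystem, Matrix.cons_val_one, Matrix.cons_val_zero, ne_eq, ite_eq_right_iff,
    one_ne_zero, imp_false, not_not]
  refine ⟨?_, fun h => ⟨a, v, rfl, h⟩⟩
  rintro ⟨a', v', h, h'⟩
  obtain ⟨rfl, rfl⟩ := tag_inj h
  exact h'

theorem ofSystem_truth (φ : HyperCTL) (B : Type1) :
    IsTrue (ofSystem T f) φ.code B ↔ T.Sat φ (Assignment.ofEnv fun k n => f (envOf B k n)) := by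
  simp only [IsTrue, ofSystem, Matrix.cons_val, ne_eq, ite_eq_right_iff,
    one_ne_zero, imp_false, not_not]
  refine ⟨?_, fun h => ⟨φ, B, rfl, h⟩⟩
  rintro ⟨φ', B', h, h'⟩
  obtain ⟨hφ, rfl⟩ := tag_inj h
  rwa [HyperCTL.code_injective hφ]

/-- Truth in `T` obeys Tarski's conditions for the pullback along `f` if existential quantifiers
can be lifted along `f`. -/
theorem isTruthPredicate_ofSystem
    (hf : ∀ (φ : HyperCTL) (π : ℕ) (e : ℕ → ℕ → Type1),
      T.Sat (.ex π φ) (Assignment.ofEnv fun k n => f (e k n)) →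
      ∃ R : ℕ → Type1, R 0 = e 0 0 ∧ T.IsPath (fun n => f (R n)) ∧
        T.Sat φ (Assignment.ofEnv (envUpdate (fun k n => f (e k n)) π fun n => f (R n)))) :
    IsTruthPredicate (ofSystem T f) := by
  have hex : ∀ (φ : HyperCTL) (π : ℕ) (B : Type1),
      T.Sat (.ex π φ) (Assignment.ofEnv fun k n => f (envOf B k n)) ↔
      ∃ R, IsPath (ofSystem T f) R ∧ (∀ i, pathOf R 0 i = envOf B 0 0 i) ∧
        IsTrue (ofSystem T f) φ.code (update B π R) := by
    intro φ π B
    constructor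
    · intro h
      obtain ⟨ρ, h₁, h₂, h₃⟩ := hf φ π _ h
      obtain ⟨R, rfl⟩ := pathOf_surjective ρ
      refine ⟨R, fun n => (ofSystem_edge _ _).2 (h₂ n), congrFun h₁, ?_⟩
      rwa [ofSystem_truth, ofEnv_envOf_update, Assignment.ofEnv_update]
    · rintro ⟨R, h₁, h₂, h₃⟩
      refine ⟨_, fun n => (ofSystem_edge _ _).1 (h₁ n), congrArg f (funext h₂), ?_⟩
      rwa [ofSystem_truth, ofEnv_envOf_update] at h₃
  have hshift : ∀ (φ : HyperCTL) (j : ℕ) (B : Type1),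
      IsTrue (ofSystem T f) φ.code (shift j B) ↔
        T.Sat φ ((Assignment.ofEnv fun k n => f (envOf B k n)).suffix j) := by
    intro φ j B
    rw [ofSystem_truth, ofEnv_envOf_shift]
  intro a b B
  obtain ⟨φ, rfl⟩ := HyperCTL.code_surjective a
  obtain ⟨ψ, rfl⟩ := HyperCTL.code_surjective b
  refine ⟨(ofSystem_truth (.atom _ _) B).trans ?_, (ofSystem_truth (.neg φ) B).trans ?_,
    (ofSystem_truth (.or φ ψ) B).trans ?_, (ofSystem_truth (.next φ) B).trans ?_,
    (ofSystem_truth (.untl φ ψ) B).trans ?_, (ofSystem_truth (.ex _ ψ) B).trans ?_,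
    (ofSystem_truth (.all _ ψ) B).trans ?_⟩
  · rw [ofSystem_label]
    refine ⟨?_, fun h => ⟨_, rfl, h⟩⟩
    rintro ⟨_, ⟨⟩, h⟩
    exact h
  · exact not_congr (ofSystem_truth φ B).symm
  · exact or_congr (ofSystem_truth φ B).symm (ofSystem_truth ψ B).symm
  · exact (hshift φ 1 B).symm
  · simp only [hshift]
    rfl
  · exact hex ψ _ B
  · -- `∀π. ψ` is dual to `∃π. ¬ψ`
    have h := hex (.neg ψ) φ.code B
    simp only [ofSystem_truth] at h ⊢
    simp only [Sat] at h ⊢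
    refine not_iff_not.1 ?_
    simpa only [not_forall, exists_prop] using h

end ofSystem

/-- `x` codes a sentence that is true, according to the truth predicate `X 2`, in the initial
vertex `v` of the system coded by `X`, in the environment whose paths are constant. -/
def IsModelCode (X : Fin 3 → Type2) (x : ℕ) : Prop :=
  IsSentenceCode x ∧ IsTruthPredicate X ∧ ∃ v, IsTrue X x (constEnv v)

theorem exists_models_iff (n : ℕ) :
    (∃ φ : HyperCTL, φ.IsSentence ∧ φ.code = n ∧ ∃ T : TransitionSystem.{u}, T.Models φ) ↔
      ∃ X, IsModelCode X n := by
  constructor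
  · rintro ⟨φ, hφ, rfl, T, hT⟩
    obtain ⟨f, ⟨v, hv⟩, -, hf⟩ := exists_covering T
    refine ⟨ofSystem T f, (isSentenceCode_code φ).2 hφ, isTruthPredicate_ofSystem hf, v, ?_⟩
    rwa [ofSystem_truth, ← models_iff_sat_ofEnv hφ _ (by rw [envOf_constEnv, hv])]
  · rintro ⟨X, hs, hX, v, hv⟩
    obtain ⟨φ, rfl⟩ := HyperCTL.code_surjective n
    have hφ := (isSentenceCode_code φ).1 hs
    exact ⟨φ, hφ, rfl, toSystem X v, (hX.models_toSystem_iff v hφ).2 hv⟩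

theorem exists_total_models_iff (n : ℕ) :
    (∃ φ : HyperCTL, φ.IsSentence ∧ φ.code = n ∧
      ∃ T : TransitionSystem.{u}, T.Total ∧ T.Models φ) ↔
      ∃ X, IsTotal X ∧ IsModelCode X n := by
  constructor
  · rintro ⟨φ, hφ, rfl, T, htotal, hT⟩
    obtain ⟨f, ⟨v, hv⟩, hsucc, hf⟩ := exists_covering T
    refine ⟨ofSystem T f, fun w => ?_, (isSentenceCode_code φ).2 hφ,
      isTruthPredicate_ofSystem hf, v, ?_⟩
    · obtain ⟨w', hw'⟩ := htotal (f w)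
      obtain ⟨w'', hw''⟩ := hsucc w w' hw'
      exact ⟨w'', (ofSystem_edge w w'').2 hw''⟩
    · rwa [ofSystem_truth, ← models_iff_sat_ofEnv hφ _ (by rw [envOf_constEnv, hv])]
  · rintro ⟨X, htotal, hs, hX, v, hv⟩
    obtain ⟨φ, rfl⟩ := HyperCTL.code_surjective n
    have hφ := (isSentenceCode_code φ).1 hs
    refine ⟨φ, hφ, rfl, toSystem X v, fun w => ?_, (hX.models_toSystem_iff v hφ).2 hv⟩
    obtain ⟨w', hw'⟩ := htotal w.down
    exact ⟨⟨w'⟩, hw'⟩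

end CodedModel

/-! ### Definability of the coding -/

namespace CodedModel

open Arith

section

variable {k m n : ℕ} {F G : (Fin k → Type2) → (Fin m → ℕ) → (Fin n → Type1) → Type1}
  {f g : (Fin k → Type2) → (Fin m → ℕ) → (Fin n → Type1) → ℕ}

theorem definableFun_tag (hf : DefinableNum f) (hF : DefinableFun F) :
    DefinableFun fun X x Y => tag (f X x Y) (F X x Y) :=
  .lam ((hf.rename Fin.succ id).pair hF)

theorem definableFun_join (hF : DefinableFun F) (hG : DefinableFun G) :
    DefinableFun fun X x Y => join (F X x Y) (G X x Y) :=
  .lam (DefinableNum.pair hF hG)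

theorem definableFun_pathOf (j : Fin n) (hf : DefinableNum f) :
    DefinableFun fun X x Y => pathOf (Y j) (f X x Y) :=
  .lam (.var_app j ((hf.rename Fin.succ id).pair (.var 0)))

theorem definableFun_envOf (j : Fin n) (hf : DefinableNum f) (hg : DefinableNum g) :
    DefinableFun fun X x Y => envOf (Y j) (f X x Y) (g X x Y) :=
  .lam (.var_app j ((hf.rename Fin.succ id).pair ((hg.rename Fin.succ id).pair (.var 0))))

theorem definableFun_shift (j : Fin n) (hf : DefinableNum f) :
    DefinableFun fun X x Y => shift (f X x Y) (Y j) :=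
  .lam (.var_app j (.pair (.unpair_fst (.var 0))
    (.pair (.add (.unpair_fst (.unpair_snd (.var 0))) (hf.rename Fin.succ id))
      (.unpair_snd (.unpair_snd (.var 0))))))

theorem definableFun_update (i j : Fin n) (hf : DefinableNum f) :
    DefinableFun fun X x Y => update (Y i) (f X x Y) (Y j) :=
  .lam (.ite (.or (.eq (.unpair_fst (.var 0)) .zero)
      (.eq (.unpair_fst (.var 0)) (.add (hf.rename Fin.succ id) .one)))
    (.var_app j (.unpair_snd (.var 0))) (.var_app i (.var 0)))

theorem definableFun_constEnv (j : Fin n) :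
    DefinableFun (k := k) (m := m) fun _ _ Y => constEnv (Y j) :=
  .lam (.var_app j (.unpair_snd (.unpair_snd (.var 0))))

theorem definableNum_code (c : ℕ) (hf : DefinableNum f) :
    DefinableNum fun X x Y => 7 * f X x Y + c :=
  ((DefinableNum.const 7).mul hf).add (.const c)

theorem definable_isFreeTable (j : Fin n) :
    Definable (k := k) (m := m) fun _ _ Y => HyperCTL.IsFreeTable (Y j) := by
  have h : ∀ {m : ℕ} {f g : (Fin k → Type2) → (Fin m → ℕ) → (Fin n → Type1) → ℕ},
      DefinableNum f → DefinableNum g →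
      Definable fun X x Y => Y j (Nat.pair (f X x Y) (g X x Y)) ≠ 0 :=
    fun hf hg => .ne (.var_app j (.pair hf hg)) .zero
  have hpair := (DefinableNum.var (k := k) (m := m + 3) (n := n) 2).pair (.var 1)
  exact .all0 <| .all0 <| .all0 <|
    .and (.iff (h (.mul (.const 7) hpair) (.var 0)) (.eq (.var 0) (.var 1))) <|
    .and (.iff (h (definableNum_code 1 (.var 2)) (.var 0)) (h (.var 2) (.var 0))) <|
    .and (.iff (h (definableNum_code 2 hpair) (.var 0))
      (.or (h (.var 2) (.var 0)) (h (.var 1) (.var 0)))) <|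
    .and (.iff (h (definableNum_code 3 (.var 2)) (.var 0)) (h (.var 2) (.var 0))) <|
    .and (.iff (h (definableNum_code 4 hpair) (.var 0))
      (.or (h (.var 2) (.var 0)) (h (.var 1) (.var 0)))) <|
    .and (.iff (h (definableNum_code 5 hpair) (.var 0))
      (.and (h (.var 1) (.var 0)) (.ne (.var 0) (.var 2))))
    (.iff (h (definableNum_code 6 hpair) (.var 0))
      (.and (h (.var 1) (.var 0)) (.ne (.var 0) (.var 2))))

theorem definable_isGuardTable (j : Fin n) :
    Definable (k := k) (m := m) fun _ _ Y => HyperCTL.IsGuardTable (Y j) := by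
  have h : ∀ {m : ℕ} {f : (Fin k → Type2) → (Fin m → ℕ) → (Fin n → Type1) → ℕ},
      DefinableNum f → Definable fun X x Y => Y j (f X x Y) ≠ 0 :=
    fun hf => .ne (.var_app j hf) .zero
  have hpair := (DefinableNum.var (k := k) (m := m + 2) (n := n) 1).pair (.var 0)
  exact .all0 <| .all0 <|
    .and (h (.mul (.const 7) hpair)) <|
    .and (.iff (h (definableNum_code 1 (.var 1))) (h (.var 1))) <|
    .and (.iff (h (definableNum_code 2 hpair)) (.and (h (.var 1)) (h (.var 0)))) <|
    .and (.eq (.var_app j (definableNum_code 3 (.var 1))) .zero) <|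
    .and (.eq (.var_app j (definableNum_code 4 hpair)) .zero) <|
    .and (h (definableNum_code 5 hpair)) (h (definableNum_code 6 hpair))

theorem definable_isSentenceCode (hf : DefinableNum f) :
    Definable fun X x Y => IsSentenceCode (f X x Y) :=
  .and
    (.ex1 (.and (definable_isFreeTable 0)
      (.all0 (.eq (.var_app 0 (.pair (hf.rename Fin.succ Fin.succ) (.var 0))) .zero))))
    (.ex1 (.and (definable_isGuardTable 0)
      (.ne (.var_app 0 (hf.rename id Fin.succ)) .zero)))

end

section

variable {m n : ℕ} {F : (Fin 3 → Type2) → (Fin m → ℕ) → (Fin n → Type1) → Type1}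
  {f : (Fin 3 → Type2) → (Fin m → ℕ) → (Fin n → Type1) → ℕ}

theorem definable_isPath (j : Fin n) : Definable (m := m) fun X _ Y => IsPath X (Y j) :=
  .all0 (.ne (.app2 0 (definableFun_join (definableFun_pathOf j (.var 0))
    (definableFun_pathOf j (.add (.var 0) .one)))) .zero)

theorem definable_isTrue (hf : DefinableNum f) (hF : DefinableFun F) :
    Definable fun X x Y => IsTrue X (f X x Y) (F X x Y) :=
  .ne (.app2 2 (definableFun_tag hf hF)) .zero

theorem definable_isTotal : Definable (m := m) (n := n) fun X _ _ => IsTotal X :=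
  .all1 (.ex1 (.ne (.app2 0 (definableFun_join (.var 1) (.var 0))) .zero))

theorem definable_isTruthPredicate :
    Definable (m := m) (n := n) fun X _ _ => IsTruthPredicate X := by
  have hpair := (DefinableNum.var (k := 3) (m := m + 2) (n := n + 1) 1).pair (.var 0)
  have hstart : Definable (k := 3) (m := m + 2) (n := n + 2) fun _ _ Y =>
      ∀ i, pathOf (Y 0) 0 i = envOf (Y 1) 0 0 i :=
    .all0 (.eq (.app1 (definableFun_pathOf 0 .zero) (.var 0))
      (.app1 (definableFun_envOf 1 .zero .zero) (.var 0)))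
  exact .all0 <| .all0 <| .all1 <|
    .and (.iff (definable_isTrue (.mul (.const 7) hpair) (.var 0))
      (.ne (.app2 1 (definableFun_tag (.var 1)
        (definableFun_envOf 0 (.add (.var 0) .one) .zero))) .zero)) <|
    .and (.iff (definable_isTrue (definableNum_code 1 (.var 1)) (.var 0))
      (.not (definable_isTrue (.var 1) (.var 0)))) <|
    .and (.iff (definable_isTrue (definableNum_code 2 hpair) (.var 0))
      (.or (definable_isTrue (.var 1) (.var 0)) (definable_isTrue (.var 0) (.var 0)))) <|
    .and (.iff (definable_isTrue (definableNum_code 3 (.var 1)) (.var 0))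
      (definable_isTrue (.var 1) (definableFun_shift 0 .one))) <|
    .and (.iff (definable_isTrue (definableNum_code 4 hpair) (.var 0))
      (.ex0 (.and (definable_isTrue (.var 1) (definableFun_shift 0 (.var 0)))
        (.all0 (.imp (.lt (.var 0) (.var 1))
          (definable_isTrue (.var 3) (definableFun_shift 0 (.var 0)))))))) <|
    .and (.iff (definable_isTrue (definableNum_code 5 hpair) (.var 0))
      (.ex1 (.and (definable_isPath 0) (.and hstart
        (definable_isTrue (.var 0) (definableFun_update 1 0 (.var 1)))))))
    (.iff (definable_isTrue (definableNum_code 6 hpair) (.var 0))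
      (.all1 (.imp (definable_isPath 0) (.imp hstart
        (definable_isTrue (.var 0) (definableFun_update 1 0 (.var 1)))))))

theorem definable_isModelCode (hf : DefinableNum f) :
    Definable fun X x Y => IsModelCode X (f X x Y) :=
  .and (definable_isSentenceCode hf) (.and definable_isTruthPredicate
    (.ex1 (definable_isTrue (hf.rename id Fin.succ) (definableFun_constEnv 0))))

end

theorem isSigma21_of_definable {P : (Fin 3 → Type2) → ℕ → Prop}
    (hP : Definable (m := 1) (n := 0) fun X x _ => P X (x 0)) : IsSigma21 {x | ∃ X, P X x} := by
  obtain ⟨ψ, hψ⟩ := hP id id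
  exact ⟨3, ψ, fun x => exists_congr fun X => (hψ X (fun _ => x) Fin.elim0).symm⟩

end CodedModel

theorem mainTheorem3 :
    IsSigma21 {n : ℕ | ∃ φ : HyperCTL, φ.IsSentence ∧ φ.code = n ∧
      ∃ T : TransitionSystem.{u}, T.Total ∧ T.Models φ} ∧
    IsSigma21 {n : ℕ | ∃ φ : HyperCTL, φ.IsSentence ∧ φ.code = n ∧
      ∃ T : TransitionSystem.{u}, T.Models φ} := by
  simp only [CodedModel.exists_total_models_iff, CodedModel.exists_models_iff]
  exact ⟨CodedModel.isSigma21_of_definable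
      (.and CodedModel.definable_isTotal (CodedModel.definable_isModelCode (.var 0))),
    CodedModel.isSigma21_of_definable (CodedModel.definable_isModelCode (.var 0))⟩
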